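/- **Definitions.** A tree is a partially ordered set $(T,\preceq)$ in which every set $\{b: b\prec a\}$ is finite and linearly ordered; $\ell(a)=|\{b:b\prec a\}|$ is the level of $a$, $T(n)$ is the set of nodes of level $n$, and $T({<}n)$, $T({\le}n)$ are defined analogously. An $\mathcal S$-tree $(T,\preceq,\Sigma,\mathcal S)$ is a countable, finitely branching tree with $T(0)$ finite, together with a set $\Sigma$ and a partial function $\mathcal S\colon T\times T^{<\omega}\times\Sigma\to T$ such that: (S1) if $\mathcal S(a,\bar p,c)$ is defined, it is an immediate successor of $a$ and all entries of $\bar p$ have level less than $\ell(a)$; (S2) $\mathcal S(a,\bar p,c)=\mathcal S(b,\bar q,d)$ implies $a=b$, $\bar p=\bar q$, $c=d$; (S3) every immediate successor of $a$ is of the form $\mathcal S(a,\bar p,c)$. An injection $F\colon T\to T$ is shape-preserving if (i) $\ell(a)=\ell(b)$ implies $\ell(F(a))=\ell(F(b))$; (ii) whenever $\mathcal S(a,\bar p,c)$ is defined, $\mathcal S(F(a),F(\bar p),c)$ is defined and $\mathcal S(F(a),F(\bar p),c)\preceq F(\mathcal S(a,\bar p,c))$; (iii) $a\in T(0)$ and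 $a\preceq b$ imply $a\preceq F(b)$. Write $\tilde F(n)$ for the common level of the nodes $F(a)$, $a\in T(n)$ (similarly for restrictions of $F$). $F$ skips level $m$ if $m\notin\tilde F[\omega]$, and skips only level $m$ if $\tilde F[\omega]=\omega\setminus\{m\}$. An $(\mathcal S,\mathcal M)$-tree is an $\mathcal S$-tree with a set $\mathcal M$ of shape-preserving functions $T\to T$ such that: (M1) $\mathcal M$ contains the identity, is closed under composition, and for every sequence $(F_i)_{i\in\omega}$ in $\mathcal M$ with $F_i\restriction_{T(\le i)}=F_{i+1}\restriction_{T(\le i)}$ for all $i$ there is $F_\infty\in\mathcal M$ with $F_\infty\restriction_{T(\le i)}=F_i\restriction_{T(\le i)}$ for all $i$; (M2) for all $n\in\omega$ and $F\in\mathcal M$ with $\tilde F(n)>0$ that skip level $\tilde F(n)-1$ there are $F_1,F_2\in\mathcal M$ such that $F_2$ skips only level $\tilde F(n)-1$ and $F_2\circ F_1\restriction_{T(\le n)}=F\restriction_{T(\le n)}$; (M3) for all $n<m$ there is $F^n_m\in\mathcal M$ skipping only level $m$ such that $F^n_m(b)=\mathcal S(b,\bar p,c)$ whenever $a\in T(n)$,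 $b\in T(m)$, $\mathcal S(a,\bar p,c)$ is defined and $\mathcal S(a,\bar p,c)\preceq b$. Let $\mathcal M^n$ be the set of $F\in\mathcal M$ that are the identity on $T({<}n)$, let $\mathcal{AM}^n_k=\{F\restriction_{T({<}n+k)}:F\in\mathcal M^n\}$, and let $\mathcal{AM}^n_k({\le}m)$ be the set of $f\in\mathcal{AM}^n_k$ with $\tilde f(n+k-1)\le m$ (no condition if $n+k=0$). **Corollary.** Let $(T,\preceq,\Sigma,\mathcal S,\mathcal M)$ be an $(\mathcal S,\mathcal M)$-tree. Then for all $n,k,m,r\in\omega$ there is $N\in\omega$ such that for every $r$-colouring $\chi\colon\mathcal{AM}^n_k({\le}N)\to\{0,\dots,r-1\}$ there are $f\in\mathcal{AM}^n_m({\le}N)$ and an extension $F\in\mathcal M^n$ of $f$ such that $F\circ g\in\mathcal{AM}^n_k({\le}N)$ for every $g\in\mathcal{AM}^n_k({\le}m)$, and $\chi$ is constant on $\{F\circ g: g\in\mathcal{AM}^n_k({\le}m)\}$. (If $n\ge1$, then $F\circ g=f\circ g$ for all these $g$, so the set is $\{f\circ g: g\in\mathcal{AM}^n_k({\le}m)\}$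 and depends only on $f$.) -/

import Mathlib

namespace SuccTree

universe u v

/-- The level `ℓ(a)` of a node: the number of its strict predecessors. -/
noncomputable def level {T : Type u} [PartialOrder T] (a : T) : ℕ :=
  (Set.Iio a).ncard

/-- An `𝒮`-tree on the partial order `T` with alphabet `A`: a countable, finitely branching tree
with finitely many nodes of level 0, and a partial successor operation
`T × T^{<ω} × A ⇀ T` (`none` means undefined) with the axioms (S1), (S2), (S3). -/
structure STree (T : Type u) [PartialOrder T] (A : Type v) where
  finite_below : ∀ a : T, (Set.Iio a).Finite
  chain_below : ∀ a : T, IsChain (· ≤ ·) (Set.Iio a)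
  countable : Countable T
  finite_branching : ∀ a : T, {b : T | a ⋖ b}.Finite
  finite_roots : {a : T | level a = 0}.Finite
  succ : T → List T → A → Option T
  succ_covBy : ∀ a p c b, succ a p c = some b → a ⋖ b ∧ ∀ q ∈ p, level q < level a
  succ_inj : ∀ a p c a' p' c' b, succ a p c = some b → succ a' p' c' = some b →
    a = a' ∧ p = p' ∧ c = c'
  succ_surj : ∀ a b, a ⋖ b → ∃ p c, succ a p c = some b

/-- Shape-preserving functions `T → T`. -/
structure ShapePreserving {T : Type u} [PartialOrder T] {A : Type v} (S : STree T A)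
    (F : T → T) : Prop where
  injective : Function.Injective F
  level_preserving : ∀ a b, level a = level b → level (F a) = level (F b)
  weakly_preserving : ∀ a p c b, S.succ a p c = some b →
    ∃ d, S.succ (F a) (p.map F) c = some d ∧ d ≤ F b
  above_root : ∀ a b, level a = 0 → a ≤ b → a ≤ F b

/-- `F` skips level `m`: no node in the range of `F` has level `m`. -/
def Skips {T : Type u} [PartialOrder T] (F : T → T) (m : ℕ) : Prop :=
  m ∉ Set.range (fun a => level (F a))

/-- `F` skips only level `m`: the levels met by the range of `F` are exactly those in `ω \ {m}`. -/
def SkipsOnly {T : Type u} [PartialOrder T] (F : T → T) (m : ℕ) : Prop :=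
  Set.range (fun a => level (F a)) = {m}ᶜ

/-- The `𝒮`-tree `S` with the set `M` of functions `T → T` is an `(𝒮, ℳ)`-tree. -/
structure IsSMTree {T : Type u} [PartialOrder T] {A : Type v} (S : STree T A)
    (M : Set (T → T)) : Prop where
  shape : ∀ F ∈ M, ShapePreserving S F
  /-- (M1) `M` is a closed monoid. -/
  id_mem : id ∈ M
  comp_mem : ∀ F ∈ M, ∀ G ∈ M, F ∘ G ∈ M
  limit_mem : ∀ F : ℕ → T → T, (∀ i, F i ∈ M) →
    (∀ i a, level a ≤ i → F i a = F (i + 1) a) →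
    ∃ G ∈ M, ∀ i a, level a ≤ i → G a = F i a
  /-- (M2) `M` admits decompositions; here `l + 1` is the level to which `F` sends level `n`. -/
  decomposition : ∀ (n l : ℕ), ∀ F ∈ M, (∃ a, level a = n ∧ level (F a) = l + 1) → Skips F l →
    ∃ F₁ ∈ M, ∃ F₂ ∈ M, SkipsOnly F₂ l ∧ ∀ a, level a ≤ n → F₂ (F₁ a) = F a
  /-- (M3) `M` is closed for duplication. -/
  duplication : ∀ n m : ℕ, n < m → ∃ F ∈ M, SkipsOnly F m ∧
    ∀ a b p c d, level a = n → level b = m → S.succ a p c = some d → d ≤ b →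
      S.succ b p c = some (F b)

/-- `T(<k)`, the nodes of level less than `k`. -/
def Below (T : Type u) [PartialOrder T] (k : ℕ) : Type u := {a : T // level a < k}

/-- The restriction `F ↾ T(<k)`. -/
def restrictBelow {T : Type u} [PartialOrder T] (k : ℕ) (F : T → T) : Below T k → T :=
  fun a => F a.1

/-- `ℳⁿ`: the members of `M` that are the identity on `T(<n)`. -/
def Fixing {T : Type u} [PartialOrder T] (M : Set (T → T)) (n : ℕ) : Set (T → T) :=
  {F | F ∈ M ∧ ∀ a, level a < n → F a = a}

/-- `𝒜ℳⁿ_k`: the restrictions of members of `ℳⁿ` to `T(<n+k)`. -/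
def AM {T : Type u} [PartialOrder T] (M : Set (T → T)) (n k : ℕ) : Set (Below T (n + k) → T) :=
  {f | ∃ F ∈ Fixing M n, f = restrictBelow (n + k) F}

/-- `𝒜ℳⁿ_k(≤m)`: those `f` in `𝒜ℳⁿ_k` which send the last level `n + k - 1` of their domain to
level at most `m`. (If `n + k = 0` there is no last level, and no condition.) -/
def AMle {T : Type u} [PartialOrder T] (M : Set (T → T)) (n k m : ℕ) :
    Set (Below T (n + k) → T) :=
  {f | f ∈ AM M n k ∧ ∀ a : Below T (n + k), level a.1 + 1 = n + k → level (f a) ≤ m}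

end SuccTree

/-! Restrictions are replaced by full members of `M`, coloured by local colourings: the colour
depends only on the values on finitely many levels. The identity below a level is detected by levels
alone, since a function fixing T(<n) satisfies a ≤ F a on T(≤n).

Decomposition (M2) says that a function can be built one new level at a time: if G sends level k to
b or higher, and all lower levels below b, then on T(≤k) it equals K ∘ Q, where Q sends k exactly to
b and K fixes T(<b) (`exists_factor`).

Duplication (M3) brings in Hales–Jewett. Call the members of `M` that skip only level p letters. On
T(≤p), composing a word of letters on the left with a suitable duplication appends a copy of any
letter already occurring in the word (`duplication_comp_compList`). Start from a word P listing
finitely many representatives of all letters and put a variable after it. Duplications can then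
append either a constant copied from P or the variable copied from its first occurrence, so every
such template comes from a member of `M` (`exists_template`). Hales–Jewett gives F with the colour
of F ∘ lam constant over all letters lam (`exists_line`).

Iterating this, the colour of F ∘ G for a colouring of T(≤p) depends only on where G sends level p
(`exists_level_dependent`). The ordinary pigeonhole principle on these levels gives the case k = 1
(`exists_pigeonhole`). For larger k, the usual proof of Ramsey's theorem applies: first make the
colour independent of the values on the last level (`exists_end_homogeneous`), then induct on k
(`exists_ramsey`). -/

namespace SuccTree

universe u v

/-! ### Levels in an 𝒮-tree -/

section Levels

variable {T : Type u} [PartialOrder T] {A : Type v} (S : STree T A)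

include S

lemma STree.level_strictMono {a b : T} (h : a < b) : level a < level b :=
  Set.ncard_lt_ncard (Set.Iio_ssubset_Iio h) (S.finite_below b)

lemma STree.level_mono {a b : T} (h : a ≤ b) : level a ≤ level b := by
  rcases h.eq_or_lt with rfl | h
  · exact le_rfl
  · exact (S.level_strictMono h).le

lemma STree.eq_of_le_of_level_eq {a b : T} (h : a ≤ b) (hl : level a = level b) : a = b := by
  rcases h.eq_or_lt with h | h
  · exact h
  · exact absurd hl (S.level_strictMono h).ne

lemma STree.comparable {a b c : T} (ha : a ≤ c) (hb : b ≤ c) : a ≤ b ∨ b ≤ a := by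
  rcases ha.eq_or_lt with rfl | ha
  · exact Or.inr hb
  rcases hb.eq_or_lt with rfl | hb
  · exact Or.inl ha.le
  exact (S.chain_below c).total ha hb

lemma STree.eq_of_level_eq {a b c : T} (ha : a ≤ c) (hb : b ≤ c) (h : level a = level b) :
    a = b := by
  rcases S.comparable ha hb with h' | h'
  · exact S.eq_of_le_of_level_eq h' h
  · exact (S.eq_of_le_of_level_eq h' h.symm).symm

lemma STree.level_covBy {a b : T} (h : a ⋖ b) : level b = level a + 1 := by
  have : Set.Iio b = insert a (Set.Iio a) := by
    ext x
    simp only [Set.mem_Iio, Set.mem_insert_iff]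
    constructor
    · intro hx
      rcases S.comparable hx.le h.le with h' | h'
      · exact h'.eq_or_lt
      · rcases h'.eq_or_lt with h' | h'
        · exact Or.inl h'.symm
        · exact absurd hx (h.2 h')
    · rintro (rfl | hx)
      · exact h.lt
      · exact hx.trans h.lt
  unfold level
  rw [this, Set.ncard_insert_of_notMem (by simp) (S.finite_below a)]

lemma STree.covBy_of_level {a b : T} (h : a ≤ b) (hl : level b = level a + 1) : a ⋖ b := by
  refine ⟨lt_of_le_of_ne h (by rintro rfl; omega), fun c hac hcb => ?_⟩
  have := S.level_strictMono hac
  have := S.level_strictMono hcb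
  omega

lemma STree.exists_covBy {b : T} (h : 0 < level b) : ∃ a, a ⋖ b := by
  have hne : (Set.Iio b).Nonempty := Set.nonempty_of_ncard_ne_zero h.ne'
  obtain ⟨a, ha⟩ := (S.finite_below b).exists_maximal hne
  refine ⟨a, ha.1, fun c hac hcb => ?_⟩
  exact absurd (ha.2 hcb hac.le) hac.not_ge

lemma STree.finite_level (n : ℕ) : {a : T | level a = n}.Finite := by
  induction n with
  | zero => exact S.finite_roots
  | succ n ih =>
    refine (ih.biUnion fun a _ => S.finite_branching a).subset fun b hb => ?_
    obtain ⟨a, hab⟩ := S.exists_covBy (b := b) (by simp only [Set.mem_ofPred_eq] at hb; omega)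
    have := S.level_covBy hab
    simp only [Set.mem_ofPred_eq] at hb
    simp only [Set.mem_iUnion]
    exact ⟨a, by simp only [Set.mem_ofPred_eq]; omega, hab⟩

lemma STree.finite_level_le (n : ℕ) : {a : T | level a ≤ n}.Finite := by
  refine ((Set.finite_Iic n).biUnion fun i _ => S.finite_level i).subset fun a ha => ?_
  simp only [Set.mem_iUnion]
  exact ⟨level a, ha, rfl⟩

lemma STree.finite_Below (k : ℕ) : Finite (Below T k) := by
  have : Finite {a : T // level a ≤ k} := (S.finite_level_le k).to_subtype
  exact Finite.of_injective (fun a : Below T k => (⟨a.1, a.2.le⟩ : {a : T // level a ≤ k}))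
    fun a b h => Subtype.ext (congrArg (fun x => x.1) h)

end Levels

/-! ### Agreement on initial levels, local colourings, level maps -/

/-- The functions `F` and `G` agree on the nodes of level less than `k`. -/
def AgreeBelow {T : Type u} [PartialOrder T] (k : ℕ) (F G : T → T) : Prop :=
  ∀ a, level a < k → F a = G a

/-- A colouring of functions is `k`-local if the colour of a function depends only on its
restriction to the nodes of level less than `k`. -/
def IsLocal {T : Type u} [PartialOrder T] {κ : Type*} (k : ℕ) (χ : (T → T) → κ) : Prop :=
  ∀ F G, AgreeBelow k F G → χ F = χ G

/-- The level to which `F` sends the nodes of level `n`. -/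
noncomputable def levelMap {T : Type u} [PartialOrder T] (F : T → T) (n : ℕ) : ℕ :=
  sInf {k | ∃ a, level a = n ∧ level (F a) = k}

lemma AgreeBelow.symm {T : Type u} [PartialOrder T] {k : ℕ} {F G : T → T}
    (h : AgreeBelow k F G) : AgreeBelow k G F := fun a ha => (h a ha).symm

lemma AgreeBelow.trans {T : Type u} [PartialOrder T] {k : ℕ} {F G H : T → T}
    (h : AgreeBelow k F G) (h' : AgreeBelow k G H) : AgreeBelow k F H :=
  fun a ha => (h a ha).trans (h' a ha)

lemma AgreeBelow.comp_left {T : Type u} [PartialOrder T] {k : ℕ} {F G : T → T}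
    (h : AgreeBelow k F G) (H : T → T) : AgreeBelow k (H ∘ F) (H ∘ G) :=
  fun a ha => congrArg H (h a ha)

/-! ### Shape-preserving functions -/

namespace ShapePreserving

variable {T : Type u} [PartialOrder T] {A : Type v} {S : STree T A} {F : T → T}

lemma level_apply (hF : ShapePreserving S F) (a : T) :
    level (F a) = levelMap F (level a) := by
  have : {k | ∃ b, level b = level a ∧ level (F b) = k} = {level (F a)} := by
    ext k
    constructor
    · rintro ⟨b, hb, rfl⟩
      exact hF.level_preserving b a hb
    · rintro rfl
      exact ⟨a, rfl, rfl⟩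
  rw [levelMap, this, csInf_singleton]

lemma strictMono (hF : ShapePreserving S F) : StrictMono F := by
  have key : ∀ n, ∀ a b : T, level b = n → a < b → F a < F b := by
    intro n
    induction n with
    | zero =>
      intro a b hb hab
      have := S.level_strictMono hab
      omega
    | succ n ih =>
      intro a b hb hab
      obtain ⟨b', hb'⟩ := S.exists_covBy (b := b) (by omega)
      have hl := S.level_covBy hb'
      obtain ⟨p, c, hpc⟩ := S.succ_surj _ _ hb'
      obtain ⟨d, hd, hdb⟩ := hF.weakly_preserving _ _ _ _ hpc
      have h1 : F b' < F b := (S.succ_covBy _ _ _ _ hd).1.lt.trans_le hdb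
      rcases S.comparable hab.le hb'.le with h | h
      · rcases h.eq_or_lt with rfl | h
        · exact h1
        · exact (ih a b' (by omega) h).trans h1
      · rcases h.eq_or_lt with rfl | h
        · exact h1
        · exact absurd hab (hb'.2 h)
  exact fun a b hab => key _ a b rfl hab

/-- The immediate predecessor of a and the parameters of the successor step leading to a all have
level less than n, so F fixes them. Weak preservation then puts that same successor, which is a,
below F a. -/
lemma le_apply (hF : ShapePreserving S F) {n : ℕ} (h : AgreeBelow n F id) {a : T}
    (ha : level a ≤ n) : a ≤ F a := by
  rcases Nat.eq_zero_or_pos (level a) with h0 | h0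
  · exact hF.above_root a a h0 le_rfl
  obtain ⟨b, hb⟩ := S.exists_covBy h0
  have hl := S.level_covBy hb
  obtain ⟨p, c, hpc⟩ := S.succ_surj _ _ hb
  obtain ⟨d, hd, hda⟩ := hF.weakly_preserving _ _ _ _ hpc
  have hp : p.map F = p := by
    conv_rhs => rw [← List.map_id p]
    refine List.map_congr_left fun q hq => h q ?_
    have := (S.succ_covBy _ _ _ _ hpc).2 q hq
    omega
  rw [hp, h b (by omega), id, hpc] at hd
  cases hd
  exact hda

lemma agreeBelow_id (hF : ShapePreserving S F) {n : ℕ} (h : ∀ i < n, levelMap F i = i) :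
    AgreeBelow n F id := by
  induction n with
  | zero => intro a ha; omega
  | succ n ih =>
    intro a ha
    have := hF.le_apply (ih fun i hi => h i (by omega)) (a := a) (by omega)
    refine (S.eq_of_le_of_level_eq this ?_).symm
    rw [hF.level_apply, h _ ha]

/-- Successors in directions whose parameters are fixed are preserved when no level is skipped. -/
lemma succ_apply (hF : ShapePreserving S F) {a b : T} {p : List T} {c : A}
    (h : S.succ a p c = some b) (hp : ∀ q ∈ p, F q = q) (hl : level (F b) = level (F a) + 1) :
    S.succ (F a) p c = some (F b) := by
  obtain ⟨d, hd, hdb⟩ := hF.weakly_preserving _ _ _ _ h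
  have hp : p.map F = p := by
    conv_rhs => rw [← List.map_id p]
    exact List.map_congr_left hp
  rw [hp] at hd
  have := S.level_covBy (S.succ_covBy _ _ _ _ hd).1
  rw [hd, S.eq_of_le_of_level_eq hdb (by omega)]

end ShapePreserving

/-! ### Level maps of members of `M` -/

namespace IsSMTree

variable {T : Type u} [PartialOrder T] {A : Type v} {S : STree T A} {M : Set (T → T)}

/-- A function skipping only level l + 1, supplied by (M3), attains level l. -/
lemma exists_level (hM : IsSMTree S M) (l : ℕ) : ∃ a : T, level a = l := by
  obtain ⟨F, -, hF, -⟩ := hM.duplication 0 (l + 1) (by omega)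
  have : l ∈ ({l + 1}ᶜ : Set ℕ) := by simp
  rw [← hF] at this
  obtain ⟨a, ha⟩ := this
  exact ⟨F a, ha⟩

lemma levelMap_strictMono (hM : IsSMTree S M) {F : T → T} (hF : F ∈ M) :
    StrictMono (levelMap F) := by
  refine strictMono_nat_of_lt_succ fun n => ?_
  obtain ⟨b, hb⟩ := hM.exists_level (n + 1)
  obtain ⟨a, ha⟩ := S.exists_covBy (b := b) (by omega)
  have hl := S.level_covBy ha
  have h := S.level_strictMono ((hM.shape F hF).strictMono ha.lt)
  rw [(hM.shape F hF).level_apply, (hM.shape F hF).level_apply, hb] at h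
  rwa [show level a = n by omega] at h

lemma levelMap_eq (hM : IsSMTree S M) {F : T → T} (hF : F ∈ M) (a : T) :
    level (F a) = levelMap F (level a) := (hM.shape F hF).level_apply a

lemma le_levelMap (hM : IsSMTree S M) {F : T → T} (hF : F ∈ M) (n : ℕ) : n ≤ levelMap F n :=
  (hM.levelMap_strictMono hF).le_apply

lemma levelMap_comp (hM : IsSMTree S M) {F G : T → T} (hF : F ∈ M) (hG : G ∈ M) (n : ℕ) :
    levelMap (F ∘ G) n = levelMap F (levelMap G n) := by
  obtain ⟨a, rfl⟩ := hM.exists_level n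
  rw [← hM.levelMap_eq (hM.comp_mem F hF G hG), ← hM.levelMap_eq hG, ← hM.levelMap_eq hF]
  rfl

lemma levelMap_id (hM : IsSMTree S M) (n : ℕ) : levelMap (id : T → T) n = n := by
  obtain ⟨a, rfl⟩ := hM.exists_level n
  rw [← hM.levelMap_eq hM.id_mem]
  rfl

lemma levelMap_congr (hM : IsSMTree S M) {F G : T → T} (hF : F ∈ M) (hG : G ∈ M) {k n : ℕ}
    (h : AgreeBelow k F G) (hn : n < k) : levelMap F n = levelMap G n := by
  obtain ⟨a, rfl⟩ := hM.exists_level n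
  rw [← hM.levelMap_eq hF, ← hM.levelMap_eq hG, h a hn]

lemma mem_Fixing (hM : IsSMTree S M) {F : T → T} (hF : F ∈ M) {n : ℕ} :
    F ∈ Fixing M n ↔ ∀ i < n, levelMap F i = i := by
  constructor
  · intro h i hi
    rw [hM.levelMap_congr hF hM.id_mem (k := n) h.2 hi, hM.levelMap_id]
  · exact fun h => ⟨hF, (hM.shape F hF).agreeBelow_id h⟩

lemma id_mem_Fixing (hM : IsSMTree S M) (n : ℕ) : id ∈ Fixing M n :=
  ⟨hM.id_mem, fun _ _ => rfl⟩

lemma Fixing_anti {n m : ℕ} (h : n ≤ m) : Fixing M m ⊆ Fixing M n :=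
  fun _ hF => ⟨hF.1, fun a ha => hF.2 a (ha.trans_le h)⟩

lemma comp_mem_Fixing (hM : IsSMTree S M) {F G : T → T} {n : ℕ} (hF : F ∈ Fixing M n)
    (hG : G ∈ Fixing M n) : F ∘ G ∈ Fixing M n :=
  ⟨hM.comp_mem F hF.1 G hG.1, fun a ha => by rw [Function.comp, hG.2 a ha, hF.2 a ha]⟩

lemma levelMap_skipsOnly (hM : IsSMTree S M) {F : T → T} (hF : F ∈ M) {m : ℕ}
    (h : SkipsOnly F m) (i : ℕ) : levelMap F i = if i < m then i else i + 1 := by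
  have hr : Set.range (levelMap F) = Set.range fun i => if i < m then i else i + 1 := by
    have h1 : Set.range (levelMap F) = {m}ᶜ := by
      rw [← h]
      ext l
      constructor
      · rintro ⟨n, rfl⟩
        obtain ⟨a, rfl⟩ := hM.exists_level n
        exact ⟨a, hM.levelMap_eq hF a⟩
      · rintro ⟨a, rfl⟩
        exact ⟨level a, (hM.levelMap_eq hF a).symm⟩
    rw [h1]
    ext l
    simp only [Set.mem_compl_iff, Set.mem_singleton_iff, Set.mem_range]
    constructor
    · intro hl
      by_cases hlm : l < m
      · exact ⟨l, by simp [hlm]⟩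
      · exact ⟨l - 1, by rw [if_neg (by omega)]; omega⟩
    · rintro ⟨y, hy⟩ rfl
      split_ifs at hy <;> omega
  have hs : StrictMono fun i => if i < m then i else i + 1 := by
    intro x y hxy
    simp only
    split_ifs <;> omega
  exact congrFun (((hM.levelMap_strictMono hF).range_inj hs).1 hr) i

lemma mem_Fixing_of_skipsOnly (hM : IsSMTree S M) {F : T → T} (hF : F ∈ M) {m : ℕ}
    (h : SkipsOnly F m) : F ∈ Fixing M m := by
  rw [hM.mem_Fixing hF]
  intro i hi
  rw [hM.levelMap_skipsOnly hF h, if_pos hi]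

/-! ### Factorisations from (M2) -/

/-- A function sending level `k` above level `b` factors through one sending `k` to `b`. -/
lemma exists_factor (hM : IsSMTree S M) {k b : ℕ} {G : T → T} (hG : G ∈ M)
    (hlow : ∀ i < k, levelMap G i < b) (hb : b ≤ levelMap G k) :
    ∃ Q ∈ M, ∃ K ∈ Fixing M b, AgreeBelow (k + 1) (K ∘ Q) G ∧ levelMap Q k = b := by
  obtain ⟨s, hs⟩ := Nat.exists_eq_add_of_le hb
  induction s generalizing G with
  | zero => exact ⟨G, hG, id, hM.id_mem_Fixing b, fun _ _ => rfl, by omega⟩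
  | succ s ih =>
    obtain ⟨x, hx⟩ := hM.exists_level k
    -- Levels less than k go below b and the others to b + s + 1 or higher, so (M2) can split off
    -- one function skipping only b + s. This lowers the image of k by one.
    have hskip : Skips G (b + s) := by
      rintro ⟨a, ha⟩
      simp only [hM.levelMap_eq hG] at ha
      rcases lt_or_ge (level a) k with h | h
      · have := hlow _ h
        omega
      · have := (hM.levelMap_strictMono hG).monotone h
        omega
    obtain ⟨F₁, hF₁, F₂, hF₂, hs₂, hcomp⟩ := hM.decomposition k (b + s) G hG
      ⟨x, hx, by rw [hM.levelMap_eq hG, hx]; omega⟩ hskip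
    have hlv : ∀ i ≤ k, levelMap F₂ (levelMap F₁ i) = levelMap G i := by
      intro i hi
      rw [← hM.levelMap_comp hF₂ hF₁]
      exact hM.levelMap_congr (hM.comp_mem _ hF₂ _ hF₁) hG (k := k + 1)
        (fun a ha => hcomp a (by omega)) (by omega)
    have h1 : ∀ i < k, levelMap F₁ i < b := fun i hi =>
      ((hM.le_levelMap hF₂ _).trans_eq (hlv i hi.le)).trans_lt (hlow i hi)
    have h2 : levelMap F₁ k = b + s := by
      have := hlv k le_rfl
      rw [hM.levelMap_skipsOnly hF₂ hs₂] at this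
      split_ifs at this <;> omega
    obtain ⟨Q, hQ, K, hK, hKQ, hl⟩ := ih hF₁ h1 (by omega) h2
    refine ⟨Q, hQ, F₂ ∘ K, hM.comp_mem_Fixing
      (Fixing_anti (by omega) (hM.mem_Fixing_of_skipsOnly hF₂ hs₂)) hK, ?_, hl⟩
    intro a ha
    have h3 : K (Q a) = F₁ a := hKQ a ha
    rw [← hcomp a (by omega), ← h3]
    rfl

/-- If `K ∘ Q` agrees with `G` and `K` fixes all levels below that of the values of `Q` on
level `k`, then `Q` agrees with `G` below level `k`. -/
lemma factor_agreeBelow (hM : IsSMTree S M) {k b : ℕ} {G Q K : T → T} (hQ : Q ∈ M)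
    (hK : K ∈ Fixing M b) (h : AgreeBelow (k + 1) (K ∘ Q) G) (hl : levelMap Q k = b) :
    AgreeBelow k Q G := by
  intro a ha
  rw [← h a (by omega), Function.comp, hK.2]
  rw [hM.levelMap_eq hQ, ← hl]
  exact hM.levelMap_strictMono hQ ha

/-- If `E` extends `F` on level `k` and agrees with it below, then `E` factors through `F`. -/
lemma exists_factor_through (hM : IsSMTree S M) {k : ℕ} {E F : T → T} (hE : E ∈ M) (hF : F ∈ M)
    (hlow : AgreeBelow k E F) (hk : ∀ a, level a = k → F a ≤ E a) :
    ∃ K ∈ Fixing M (levelMap F k), AgreeBelow (k + 1) (K ∘ F) E := by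
  have hb : levelMap F k ≤ levelMap E k := by
    obtain ⟨x, rfl⟩ := hM.exists_level k
    rw [← hM.levelMap_eq hF, ← hM.levelMap_eq hE]
    exact S.level_mono (hk x rfl)
  obtain ⟨Q, hQ, K, hK, hKQ, hl⟩ := hM.exists_factor hE (fun i hi => by
    rw [hM.levelMap_congr hE hF hlow hi]
    exact hM.levelMap_strictMono hF hi) hb
  have hQE := hM.factor_agreeBelow hQ hK hKQ hl
  refine ⟨K, hK, fun a ha => ?_⟩
  rw [← hKQ a ha, Function.comp, Function.comp]
  congr 1
  rcases Nat.lt_succ_iff_lt_or_eq.1 ha with h | h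
  · rw [hQE a h, hlow a h]
  · have h1 : Q a ≤ E a := by
      rw [← hKQ a ha]
      exact (hM.shape K hK.1).le_apply hK.2 (by rw [hM.levelMap_eq hQ, h, hl])
    refine S.eq_of_level_eq (hk a h) h1 ?_
    rw [hM.levelMap_eq hF, hM.levelMap_eq hQ, h, hl]

/-! ### Words of letters and the Hales–Jewett theorem -/

/-- The members of `M` skipping only level `p`. -/
def letters (M : Set (T → T)) (p : ℕ) : Set (T → T) := {F | F ∈ M ∧ SkipsOnly F p}

/-- Factor G through a Q sending p to p + 1. Applying (M2) to Q, the inner function must be the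
identity on T(≤p) by comparing levels, so the outer one is a letter agreeing with Q there. -/
lemma exists_letter_factor (hM : IsSMTree S M) {p : ℕ} {G : T → T} (hG : G ∈ Fixing M p)
    (hp : p < levelMap G p) : ∃ lam ∈ letters M p, ∃ K ∈ Fixing M (p + 1),
      AgreeBelow (p + 1) (K ∘ lam) G ∧ levelMap K (p + 1) = levelMap G p := by
  have hGlow := (hM.mem_Fixing hG.1).1 hG
  obtain ⟨Q, hQ, K, hK, hKQ, hl⟩ := hM.exists_factor (b := p + 1) hG.1
    (fun i hi => by rw [hGlow i hi]; omega) hp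
  have hQG := hM.factor_agreeBelow hQ hK hKQ hl
  have hQlow : ∀ i < p, levelMap Q i = i := fun i hi => by
    rw [hM.levelMap_congr hQ hG.1 hQG hi, hGlow i hi]
  obtain ⟨x, hx⟩ := hM.exists_level p
  obtain ⟨F₁, hF₁, F₂, hF₂, hs₂, hcomp⟩ := hM.decomposition p p Q hQ
    ⟨x, hx, by rw [hM.levelMap_eq hQ, hx, hl]⟩ (by
      rintro ⟨a, ha⟩
      simp only [hM.levelMap_eq hQ] at ha
      rcases lt_or_ge (level a) p with h | h
      · rw [hQlow _ h] at ha
        omega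
      · have := (hM.levelMap_strictMono hQ).monotone h
        omega)
  have h1 : AgreeBelow (p + 1) F₁ id := by
    refine (hM.shape F₁ hF₁).agreeBelow_id fun i hi => ?_
    have h2 : levelMap F₂ (levelMap F₁ i) = levelMap Q i := by
      rw [← hM.levelMap_comp hF₂ hF₁]
      exact hM.levelMap_congr (hM.comp_mem _ hF₂ _ hF₁) hQ (k := p + 1)
        (fun a ha => hcomp a (by omega)) hi
    rw [hM.levelMap_skipsOnly hF₂ hs₂] at h2
    have := hM.le_levelMap hF₁ i
    rcases Nat.lt_succ_iff_lt_or_eq.1 hi with h | h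
    · rw [hQlow i h] at h2
      split_ifs at h2 <;> omega
    · subst h
      rw [hl] at h2
      split_ifs at h2 <;> omega
  have h3 : AgreeBelow (p + 1) F₂ Q := by
    intro a ha
    rw [← hcomp a (by omega), h1 a ha]
    rfl
  refine ⟨F₂, ⟨hF₂, hs₂⟩, K, hK, (h3.comp_left K).trans hKQ, ?_⟩
  rw [← hl, ← hM.levelMap_comp hK.1 hQ]
  exact hM.levelMap_congr (hM.comp_mem _ hK.1 _ hQ) hG.1 hKQ (by omega)

/-- The composition of a list of functions. -/
def compList {T : Type u} (l : List (T → T)) : T → T := l.foldr (· ∘ ·) id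

lemma compList_cons {T : Type u} (F : T → T) (l : List (T → T)) :
    compList (F :: l) = F ∘ compList l := rfl

lemma compList_append {T : Type u} (l l' : List (T → T)) :
    compList (l ++ l') = compList l ∘ compList l' := by
  induction l with
  | nil => rfl
  | cons F l ih => rw [List.cons_append, compList_cons, ih, compList_cons]; rfl

lemma compList_mem (hM : IsSMTree S M) {p : ℕ} {l : List (T → T)}
    (hl : ∀ F ∈ l, F ∈ letters M p) : compList l ∈ Fixing M p := by
  induction l with
  | nil => exact hM.id_mem_Fixing p
  | cons F l ih =>
    have hF := hl F (by simp)
    rw [compList_cons]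
    exact hM.comp_mem_Fixing (hM.mem_Fixing_of_skipsOnly hF.1 hF.2)
      (ih fun G hG => hl G (by simp [hG]))

lemma levelMap_compList (hM : IsSMTree S M) {p : ℕ} {l : List (T → T)}
    (hl : ∀ F ∈ l, F ∈ letters M p) (i : ℕ) :
    levelMap (compList l) (p + i) = p + l.length + i := by
  induction l with
  | nil => exact hM.levelMap_id _
  | cons F l ih =>
    have hF := hl F (by simp)
    have hl' : ∀ G ∈ l, G ∈ letters M p := fun G hG => hl G (by simp [hG])
    rw [compList_cons, hM.levelMap_comp hF.1 (hM.compList_mem hl').1, ih hl',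
      hM.levelMap_skipsOnly hF.1 hF.2, if_neg (by omega), List.length_cons]
    omega

/-- Duplicating the level of a letter of a word appends that letter to the word. -/
lemma duplication_comp_compList (hM : IsSMTree S M) {p : ℕ} {l l' : List (T → T)} {F D : T → T}
    (hl : ∀ G ∈ l ++ F :: l', G ∈ letters M p) (hD : D ∈ M)
    (hs : SkipsOnly D (p + (l ++ F :: l').length))
    (hdup : ∀ a b q c d, level a = p + l.length → level b = p + (l ++ F :: l').length →
      S.succ a q c = some d → d ≤ b → S.succ b q c = some (D b)) :
    AgreeBelow (p + 1) (D ∘ compList (l ++ F :: l')) (compList (l ++ F :: l' ++ [F])) := by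
  have hF := hl F (by simp)
  have hl₁ : ∀ G ∈ l, G ∈ letters M p := fun G hG => hl G (by simp [hG])
  have hl₂ : ∀ G ∈ l', G ∈ letters M p := fun G hG => hl G (by simp [hG])
  have hl₃ : ∀ G ∈ l ++ F :: l' ++ [F], G ∈ letters M p := by
    intro G hG
    rcases List.mem_append.1 hG with h | h
    · exact hl G h
    · rw [List.mem_singleton.1 h]
      exact hF
  have hFfix := hM.mem_Fixing_of_skipsOnly hF.1 hF.2
  set w := l ++ F :: l' with hw
  have hwfix := hM.compList_mem hl
  intro a ha
  rcases Nat.lt_succ_iff_lt_or_eq.1 ha with h | h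
  · rw [(hM.compList_mem hl₃).2 a h, Function.comp, hwfix.2 a h]
    exact (hM.mem_Fixing_of_skipsOnly hD hs).2 a (by omega)
  have hlF : level (F a) = level a + 1 := by
    rw [hM.levelMap_eq hF.1, hM.levelMap_skipsOnly hF.1 hF.2, h, if_neg (lt_irrefl _)]
  obtain ⟨q, c, hqc⟩ := S.succ_surj a (F a)
    (S.covBy_of_level ((hM.shape F hF.1).le_apply hFfix.2 h.le) hlF)
  have hq : ∀ x ∈ q, level x < p := fun x hx => by
    have := (S.succ_covBy _ _ _ _ hqc).2 x hx
    omega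
  -- Each word v fixes the parameters q, which lie below level p, and sends levels p and p + 1 to
  -- consecutive levels. Hence v carries the successor F a of a to the successor of v a with the
  -- same q and c.
  have key : ∀ v : List (T → T), (∀ G ∈ v, G ∈ letters M p) →
      S.succ (compList v a) q c = some (compList v (F a)) := by
    intro v hv
    have hvfix := hM.compList_mem hv
    refine (hM.shape _ hvfix.1).succ_apply hqc (fun x hx => hvfix.2 x (hq x hx)) ?_
    rw [hM.levelMap_eq hvfix.1, hM.levelMap_eq hvfix.1, hlF, h, hM.levelMap_compList hv,
      ← Nat.add_zero p, Nat.add_assoc, hM.levelMap_compList hv]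
    omega
  have hlev : ∀ v : List (T → T), (∀ G ∈ v, G ∈ letters M p) →
      level (compList v a) = p + v.length := by
    intro v hv
    rw [hM.levelMap_eq (hM.compList_mem hv).1, h]
    exact hM.levelMap_compList hv 0
  have hle : compList l (F a) ≤ compList w a := by
    rw [hw, compList_append, compList_cons]
    refine (hM.shape _ (hM.compList_mem hl₁).1).strictMono.monotone
      ((hM.shape F hF.1).strictMono.monotone ?_)
    exact (hM.shape _ (hM.compList_mem hl₂).1).le_apply (hM.compList_mem hl₂).2 h.le
  have h1 := hdup _ _ _ _ _ (hlev l hl₁) (hlev w hl) (key l hl₁) hle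
  have h2 := key w hl
  rw [h1, Option.some_inj] at h2
  rw [Function.comp, h2, compList_append w]
  rfl

lemma exists_finite_letters (hM : IsSMTree S M) (p : ℕ) :
    ∃ R ⊆ letters M p, R.Finite ∧ ∀ F ∈ letters M p, ∃ G ∈ R, AgreeBelow (p + 1) F G := by
  obtain ⟨R, hR, hbij⟩ := Set.SurjOn.exists_bijOn_subset
    (Set.surjOn_image (restrictBelow (p + 1)) (letters M p))
  refine ⟨R, hR, ?_, fun F hF => ?_⟩
  · have : Finite (Below T (p + 1)) := S.finite_Below _
    have : Finite {a : T // level a ≤ p + 1} := (S.finite_level_le _).to_subtype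
    have hfin : (Set.range fun (f : Below T (p + 1) → {a : T // level a ≤ p + 1}) x =>
        (f x).1).Finite := Set.finite_range _
    refine Set.Finite.of_finite_image ?_ hbij.injOn
    refine hfin.subset ?_
    rintro _ ⟨F, hF, rfl⟩
    refine ⟨fun x => ⟨F x.1, ?_⟩, rfl⟩
    have := x.2
    rw [hM.levelMap_eq (hR hF).1, hM.levelMap_skipsOnly (hR hF).1 (hR hF).2]
    split_ifs <;> omega
  · obtain ⟨G, hG, h⟩ := hbij.surjOn ⟨F, hF, rfl⟩
    exact ⟨G, hG, fun a ha => (congrFun h ⟨a, ha⟩).symm⟩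

/-- Every template with a variable, whose constant prefix contains all letters, is realised by a
member of `M`. -/
lemma exists_template (hM : IsSMTree S M) {p : ℕ} {R : Set (T → T)} (hR : R ⊆ letters M p)
    {P : List (T → T)} (hP : ∀ F ∈ P, F ∈ R) (hall : ∀ F ∈ R, F ∈ P) (σ : List (Option R)) :
    ∃ F ∈ Fixing M p,
      (∀ i, levelMap F (p + 1 + i) = p + (P.length + 1 + σ.length) + i) ∧
      ∀ lam : R, AgreeBelow (p + 1) (F ∘ lam)
        (compList (P ++ lam.1 :: σ.map fun o => (o.getD lam).1)) := by
  induction σ using List.reverseRecOn with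
  | nil =>
    have hP' : ∀ F ∈ P, F ∈ letters M p := fun F hF => hR (hP F hF)
    refine ⟨compList P, hM.compList_mem hP', fun i => ?_, fun lam => ?_⟩
    · rw [Nat.add_assoc, hM.levelMap_compList hP', List.length_nil]
      omega
    · rw [compList_append]
      exact fun _ _ => rfl
  | append_singleton σ o ih =>
    obtain ⟨F, hF, hlev, hword⟩ := ih
    -- The position s of the letter to be copied must not depend on lam: the variable is copied from
    -- its first occurrence, at position `P.length`, and a constant from inside `P`.
    have hsplit : ∃ (s : ℕ), s < P.length + 1 + σ.length ∧ ∀ lam : R, ∃ l l', l.length = s ∧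
        P ++ lam.1 :: σ.map (fun o => (o.getD lam).1) = l ++ (o.getD lam).1 :: l' := by
      cases o with
      | none => exact ⟨P.length, by omega, fun lam => ⟨P, _, rfl, rfl⟩⟩
      | some G =>
        obtain ⟨P₁, P₂, hP₁₂⟩ := List.append_of_mem (hall G.1 G.2)
        refine ⟨P₁.length, ?_, fun lam => ⟨P₁, P₂ ++ lam.1 :: σ.map fun o => (o.getD lam).1,
          rfl, ?_⟩⟩
        · rw [hP₁₂, List.length_append]
          omega
        · rw [hP₁₂]
          simp
    obtain ⟨s, hs, hsplit⟩ := hsplit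
    obtain ⟨D, hD, hskip, hdup⟩ := hM.duplication (p + s) (p + (P.length + 1 + σ.length))
      (by omega)
    refine ⟨D ∘ F, hM.comp_mem_Fixing
      (Fixing_anti (by omega) (hM.mem_Fixing_of_skipsOnly hD hskip)) hF, fun i => ?_,
      fun lam => ?_⟩
    · rw [hM.levelMap_comp hD hF.1, hlev, hM.levelMap_skipsOnly hD hskip, if_neg (by omega),
        List.length_append, List.length_singleton]
      omega
    · obtain ⟨l, l', hl, heq⟩ := hsplit lam
      have hlen : (l ++ (o.getD lam).1 :: l').length = P.length + 1 + σ.length := by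
        rw [← heq, List.length_append, List.length_cons, List.length_map]
        omega
      have hmem : ∀ G ∈ l ++ (o.getD lam).1 :: l', G ∈ letters M p := by
        rw [← heq]
        intro G hG
        simp only [List.mem_append, List.mem_cons, List.mem_map] at hG
        rcases hG with h | rfl | ⟨x, -, rfl⟩
        · exact hR (hP G h)
        · exact hR lam.2
        · exact hR (x.getD lam).2
      have h1 := (hword lam).comp_left D
      rw [heq] at h1
      have h2 := hM.duplication_comp_compList hmem hD (by rwa [hlen])
        (by rw [hlen, hl]; exact hdup)
      rw [List.map_append, ← List.cons_append, ← List.append_assoc, heq]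
      exact h1.trans h2

/-- The one-step Ramsey statement, obtained from the Hales–Jewett theorem. -/
lemma exists_line (hM : IsSMTree S M) (p : ℕ) (κ : Type*) [Finite κ] :
    ∃ N, ∀ χ : (T → T) → κ, IsLocal (p + 1) χ → ∃ F ∈ Fixing M p,
      (∀ i, levelMap F (p + 1 + i) = N + i) ∧
      ∃ c, ∀ lam ∈ letters M p, χ (F ∘ lam) = c := by
  classical
  obtain ⟨R, hR, hfin, hrep⟩ := hM.exists_finite_letters p
  have : Finite R := hfin.to_subtype
  obtain ⟨ι, _, hι⟩ := Combinatorics.Line.exists_mono_in_high_dimension R κ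
  -- The prefix u makes every representative letter available for copying, whatever line is found.
  set u : List (T → T) := hfin.toFinset.toList with hu
  have hmem : ∀ F, F ∈ u ↔ F ∈ R := by simp [hu]
  set e : List ι := Finset.univ.toList with he
  refine ⟨p + (u.length + e.length), fun χ hχ => ?_⟩
  obtain ⟨l, c, hc⟩ := hι fun x => χ (compList (u ++ e.map fun i => (x i).1))
  obtain ⟨i₀, hi₀⟩ := l.proper
  have hnone : none ∈ e.map l.idxFun :=
    List.mem_map.2 ⟨i₀, by simp [he], hi₀⟩
  -- The template is cut at the first active coordinate; the constants before it are absorbed into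
  -- the prefix.
  obtain ⟨τ, σ, hτσ, hτ⟩ := List.eq_append_cons_of_mem hnone
  obtain ⟨τ', rfl⟩ : ∃ τ' : List R, τ = τ'.map some := by
    refine ⟨τ.reduceOption, ?_⟩
    clear hτσ
    induction τ with
    | nil => rfl
    | cons o τ ih =>
      cases o with
      | none => simp at hτ
      | some x =>
        rw [List.reduceOption_cons_of_some, List.map_cons, ← ih fun h => hτ (by simp [h])]
  obtain ⟨F, hF, hlev, hword⟩ := hM.exists_template hR
    (P := u ++ τ'.map Subtype.val) (by
      intro G hG
      rcases List.mem_append.1 hG with h | h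
      · exact (hmem G).1 h
      · obtain ⟨x, -, rfl⟩ := List.mem_map.1 h
        exact x.2) (fun G hG => List.mem_append.2 (Or.inl ((hmem G).2 hG))) σ
  refine ⟨F, hF, fun i => ?_, c, fun lam hlam => ?_⟩
  · have := congrArg List.length hτσ
    simp only [List.length_append, List.length_map, List.length_cons] at this
    rw [hlev, List.length_append, List.length_map]
    omega
  · obtain ⟨mu, hmu, hlm⟩ := hrep lam hlam
    rw [← hc ⟨mu, hmu⟩]
    refine hχ _ _ ((hlm.comp_left F).trans ((hword ⟨mu, hmu⟩).trans ?_))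
    have h1 : (e.map fun i => (l ⟨mu, hmu⟩ i).1) =
        (e.map l.idxFun).map fun o => (o.getD ⟨mu, hmu⟩).1 := by
      rw [List.map_map]
      rfl
    rw [h1, hτσ]
    simp only [List.map_append, List.map_map, List.map_cons, List.append_assoc]
    exact fun _ _ => rfl

end IsSMTree

/-! ### Constructing local colourings -/

/-- Extend a function on the nodes of level less than `k` by the identity. -/
noncomputable def extendBelow {T : Type u} [PartialOrder T] {k L : ℕ}
    (x : Below T k → {a : T // level a ≤ L}) : T → T :=
  open Classical in fun a => if h : level a < k then (x ⟨a, h⟩).1 else a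

lemma STree.finite_Below_fun {T : Type u} [PartialOrder T] {A : Type v} (S : STree T A)
    (k L : ℕ) : Finite (Below T k → {a : T // level a ≤ L}) := by
  have : Finite (Below T k) := S.finite_Below _
  have : Finite {a : T // level a ≤ L} := (S.finite_level_le _).to_subtype
  infer_instance

lemma exists_agreeBelow_extendBelow {T : Type u} [PartialOrder T] {k L : ℕ} {F : T → T}
    (h : ∀ a, level a < k → level (F a) ≤ L) :
    ∃ x : Below T k → {a : T // level a ≤ L}, AgreeBelow k F (extendBelow x) := by
  refine ⟨fun a => ⟨F a.1, h a.1 a.2⟩, fun a ha => ?_⟩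
  rw [extendBelow, dif_pos ha]

/-- Records in a single colour, from a finite set if the original colours are, how χ colours H ∘ E ∘
x for all the finitely many x at once. Homogenising E for it thus treats every inner function x
simultaneously. -/
lemma IsLocal.comp_extendBelow {T : Type u} [PartialOrder T] {κ : Type*} {k L : ℕ}
    {χ : (T → T) → κ} (hχ : IsLocal k χ) (H : T → T) :
    IsLocal (L + 1) fun (E : T → T) (x : Below T k → {a : T // level a ≤ L}) =>
      χ (H ∘ E ∘ extendBelow x) := by
  intro E E' h
  funext x
  refine hχ _ _ fun a ha => congrArg H (h _ ?_)
  rw [extendBelow, dif_pos ha]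
  exact Nat.lt_succ_of_le (x ⟨a, ha⟩).2

/-- A colouring obtained by choosing a witness of a local property is local. -/
lemma exists_isLocal_choice {T : Type u} [PartialOrder T] {κ X : Type*} {k : ℕ}
    {P : (T → T) → X → Prop} (hP : ∀ E E', AgreeBelow k E E' → ∀ x, P E x → P E' x)
    (φ : X → κ) (c : κ) : ∃ χ : (T → T) → κ, IsLocal k χ ∧
      ∀ E, (∃ x, P E x) → ∃ x, P E x ∧ χ E = φ x := by
  classical
  refine ⟨fun E => if h : ∃ x, P E x then φ h.choose else c, fun E E' h => ?_, fun E h => ?_⟩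
  · have : P E = P E' := funext fun x => propext ⟨hP E E' h x, hP E' E h.symm x⟩
    simp only [this]
  · exact ⟨h.choose, h.choose_spec, dif_pos h⟩

/-! ### The pigeonhole principle -/

namespace IsSMTree

variable {T : Type u} [PartialOrder T] {A : Type v} {S : STree T A} {M : Set (T → T)}

lemma agreeBelow_succ_of_levelMap_eq (hM : IsSMTree S M) {p : ℕ} {G : T → T}
    (hG : G ∈ Fixing M p) (h : levelMap G p = p) : AgreeBelow (p + 1) G id := by
  refine (hM.shape G hG.1).agreeBelow_id fun i hi => ?_
  rcases Nat.lt_succ_iff_lt_or_eq.1 hi with h' | rfl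
  · exact (hM.mem_Fixing hG.1).1 hG i h'
  · exact h

/-- Induction on s with p varying. A function G moving level p is K ∘ lam on T(≤p) for a letter lam.
The induction hypothesis, at the level L to which F sends p + 1, makes the colour depend on K only
through a level; `exists_line` removes the dependence on lam. -/
lemma exists_level_dependent (hM : IsSMTree S M) (s : ℕ) :
    ∀ (p : ℕ) (κ : Type u) [Finite κ], ∃ N, ∀ χ : (T → T) → κ, IsLocal (p + 1) χ →
      ∃ F ∈ Fixing M p, levelMap F (p + s) ≤ N ∧
        ∃ c : ℕ → κ, ∀ G ∈ Fixing M p, levelMap G p ≤ p + s → χ (F ∘ G) = c (levelMap G p) := by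
  induction s with
  | zero =>
    intro p κ _
    refine ⟨p, fun χ hχ => ⟨id, hM.id_mem_Fixing p, (hM.levelMap_id _).le,
      fun _ => χ id, fun G hG hl => hχ _ _ ?_⟩⟩
    exact hM.agreeBelow_succ_of_levelMap_eq hG (le_antisymm hl (hM.le_levelMap hG.1 p))
  | succ s ih =>
    intro p κ _
    obtain ⟨L, hL⟩ := hM.exists_line p (Fin (s + 1) → κ)
    have := S.finite_Below_fun (p + 1) L
    obtain ⟨N, hN⟩ := ih L ((Below T (p + 1) → {a : T // level a ≤ L}) → κ)
    refine ⟨N, fun χ hχ => ?_⟩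
    obtain ⟨Φ, hΦ, hΦN, c, hc⟩ := hN _ (hχ.comp_extendBelow id)
    -- The new colour of E is the whole table of colours, indexed by the excess t over L, that E
    -- would receive as the inner function x.
    obtain ⟨χ', hχ', hchoice⟩ := exists_isLocal_choice (k := p + 1)
      (P := fun E (x : Below T (p + 1) → {a : T // level a ≤ L}) =>
        AgreeBelow (p + 1) E (extendBelow x)) (fun E E' h x => h.symm.trans)
      (fun x (t : Fin (s + 1)) => c (L + t.1) x) (fun _ => χ id)
    obtain ⟨F, hF, hlev, d, hd⟩ := hL χ' hχ'
    have hpL : p ≤ L := by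
      have := hM.le_levelMap hF.1 (p + 1 + 0)
      rw [hlev] at this
      omega
    -- The index l - (p + 1) is the excess t. The default value serves l = p, where G is the
    -- identity on T(≤p).
    refine ⟨Φ ∘ F, hM.comp_mem_Fixing (Fixing_anti hpL hΦ) hF, ?_,
      fun l => if h : l - (p + 1) < s + 1 ∧ p < l then d ⟨l - (p + 1), h.1⟩ else χ (Φ ∘ F),
      fun G hG hl => ?_⟩
    · rw [hM.levelMap_comp hΦ.1 hF.1, show p + (s + 1) = p + 1 + s by omega, hlev]
      exact hΦN
    rcases (hM.le_levelMap hG.1 p).eq_or_lt with h | h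
    · simp only [← h, lt_irrefl, and_false, dif_neg, not_false_eq_true]
      exact hχ _ _ ((hM.agreeBelow_succ_of_levelMap_eq hG h.symm).comp_left _)
    · have hs : levelMap G p - (p + 1) < s + 1 := by omega
      simp only [hs, h, and_self, dif_pos]
      obtain ⟨lam, hlam, K, hK, hKlam, hKl⟩ := hM.exists_letter_factor hG h
      -- Moves K past F: F ∘ K agrees with K' ∘ F on T(≤p+1), with K' fixing T(<L), the form
      -- required for Φ.
      obtain ⟨K', hK', hKF⟩ := hM.exists_factor_through (k := p + 1)
        (hM.comp_mem F hF.1 K hK.1) hF.1 (AgreeBelow.comp_left hK.2 F)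
        (fun a ha => (hM.shape F hF.1).strictMono.monotone
          ((hM.shape K hK.1).le_apply hK.2 ha.le))
      have hL0 : levelMap F (p + 1) = L := hlev 0
      rw [hL0] at hK'
      have hlamlev : ∀ a, level a < p + 1 → level (lam a) ≤ p + 1 := fun a ha => by
        rw [hM.levelMap_eq hlam.1, hM.levelMap_skipsOnly hlam.1 hlam.2]
        split_ifs <;> omega
      have hex : ∃ x : Below T (p + 1) → {a : T // level a ≤ L},
          AgreeBelow (p + 1) (F ∘ lam) (extendBelow x) :=
        exists_agreeBelow_extendBelow fun a ha => by
          rw [Function.comp, hM.levelMap_eq hF.1, ← hL0]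
          exact (hM.levelMap_strictMono hF.1).monotone (hlamlev a ha)
      obtain ⟨x, hx, hχx⟩ := hchoice _ hex
      rw [← hd lam hlam, hχx]
      have hK'l : levelMap K' L = L + (levelMap G p - (p + 1)) := by
        rw [← hL0, ← hM.levelMap_comp hK'.1 hF.1,
          hM.levelMap_congr (hM.comp_mem _ hK'.1 _ hF.1) (hM.comp_mem _ hF.1 _ hK.1) hKF
            (Nat.lt_succ_self _), hM.levelMap_comp hF.1 hK.1, hKl, hL0,
          ← hlev (levelMap G p - (p + 1))]
        congr 1
        omega
      have h2 := congrFun (hc K' hK' (by omega)) x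
      rw [hK'l] at h2
      refine Eq.trans ?_ h2
      refine hχ _ _ fun a ha => ?_
      have h3 : (F ∘ K) (lam a) = K' (F (lam a)) :=
        (hKF (lam a) (Nat.lt_succ_of_le (hlamlev a ha))).symm
      have h4 : F (lam a) = extendBelow x a := hx a ha
      have h5 : K (lam a) = G a := hKlam a ha
      simp only [Function.comp, id] at h3 ⊢
      rw [← h5, h3, h4]

/-- Compose d copies of one function skipping only level l. For l > n, (M3) provides it; for l = n
it has to be assumed. -/
lemma exists_levelMap_shift (hM : IsSMTree S M) {n : ℕ} (hn : ∃ F ∈ M, SkipsOnly F n) {l : ℕ}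
    (hl : n ≤ l) (d : ℕ) : ∃ K ∈ Fixing M l, ∀ i, levelMap K (l + i) = l + d + i := by
  obtain ⟨F, hF, hs⟩ : ∃ F ∈ M, SkipsOnly F l := by
    rcases hl.eq_or_lt with rfl | h
    · exact hn
    · obtain ⟨F, hF, hs, -⟩ := hM.duplication n l h
      exact ⟨F, hF, hs⟩
  induction d with
  | zero => exact ⟨id, hM.id_mem_Fixing l, fun i => hM.levelMap_id _⟩
  | succ d ih =>
    obtain ⟨K, hK, hlev⟩ := ih
    refine ⟨F ∘ K, hM.comp_mem_Fixing (hM.mem_Fixing_of_skipsOnly hF hs) hK, fun i => ?_⟩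
    rw [hM.levelMap_comp hF hK.1, hlev, hM.levelMap_skipsOnly hF hs, if_neg (by omega)]
    omega

lemma exists_levelMap_eq (hM : IsSMTree S M) {n : ℕ} (hn : ∃ F ∈ M, SkipsOnly F n)
    {e : ℕ → ℕ} (he : n ≤ e 0) (j : ℕ) (hmono : ∀ i < j, e i < e (i + 1)) :
    ∃ H ∈ Fixing M n, (∀ i ≤ j, levelMap H (n + i) = e i) ∧
      ∀ i, levelMap H (n + j + i) = e j + i := by
  induction j with
  | zero =>
    obtain ⟨K, hK, hlev⟩ := hM.exists_levelMap_shift hn le_rfl (e 0 - n)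
    have h : ∀ i, levelMap K (n + i) = e 0 + i := fun i => by rw [hlev]; omega
    refine ⟨K, hK, fun i hi => ?_, h⟩
    rw [h, Nat.le_zero.1 hi, Nat.add_zero]
  | succ j ih =>
    obtain ⟨H, hH, h1, h2⟩ := ih fun i hi => hmono i (by omega)
    have hj := hmono j (by omega)
    have hnj : n ≤ e j := by
      have := hM.le_levelMap hH.1 (n + j)
      rw [h1 j le_rfl] at this
      omega
    obtain ⟨K, hK, hlev⟩ := hM.exists_levelMap_shift hn (l := e j + 1) (by omega)
      (e (j + 1) - (e j + 1))
    have h3 : ∀ i, levelMap (K ∘ H) (n + (j + 1) + i) = e (j + 1) + i := fun i => by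
      rw [hM.levelMap_comp hK.1 hH.1, show n + (j + 1) + i = n + j + (1 + i) by omega, h2,
        ← Nat.add_assoc, hlev]
      omega
    refine ⟨K ∘ H, hM.comp_mem_Fixing (Fixing_anti (by omega) hK) hH, fun i hi => ?_, h3⟩
    rcases Nat.le_succ_iff.1 hi with h | rfl
    · rw [hM.levelMap_comp hK.1 hH.1, (hM.mem_Fixing hK.1).1 hK, h1 i h]
      have := (hM.levelMap_strictMono hH.1).monotone (show n + i ≤ n + j by omega)
      rw [h1 j le_rfl] at this
      omega
    · exact h3 0

/-- The pigeonhole principle: the case `k = 1` of the Ramsey statement. -/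
lemma exists_pigeonhole (hM : IsSMTree S M) (n m : ℕ) (κ : Type u) [Finite κ] :
    ∃ N, ∀ χ : (T → T) → κ, IsLocal (n + 1) χ → ∃ F ∈ Fixing M n, levelMap F m ≤ N ∧
      ∃ c, ∀ G ∈ Fixing M n, levelMap G n ≤ m → χ (F ∘ G) = c := by
  classical
  by_cases hn : ∃ F ∈ M, SkipsOnly F n
  -- Among card κ * m + 1 levels some m + 1 have the same colour. H sends n, …, n + m to these, so
  -- every G moving n to at most m has H ∘ G sending n to one of them.
  · have := Fintype.ofFinite κ
    obtain ⟨N, hN⟩ := hM.exists_level_dependent (Fintype.card κ * m) n κ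
    refine ⟨N, fun χ hχ => ?_⟩
    obtain ⟨F, hF, hFN, c, hc⟩ := hN χ hχ
    have : Nonempty κ := ⟨χ id⟩
    obtain ⟨y, -, hy⟩ := Finset.exists_lt_card_fiber_of_mul_lt_card_of_maps_to
      (s := Finset.range (Fintype.card κ * m + 1)) (t := Finset.univ) (n := m)
      (f := fun i => c (n + i)) (fun _ _ => Finset.mem_univ _) (by simp)
    obtain ⟨X, hX⟩ : ∃ X, X = {i ∈ Finset.range (Fintype.card κ * m + 1) | c (n + i) = y} :=
      ⟨_, rfl⟩
    rw [← hX] at hy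
    have hfin : {i | i ∈ X}.Finite := X.finite_toSet
    have hcard : hfin.toFinset.card = X.card := by
      congr 1
      ext
      exact hfin.mem_toFinset
    have hmemX : ∀ i ≤ m, Nat.nth (· ∈ X) i < Fintype.card κ * m + 1 ∧
        c (n + Nat.nth (· ∈ X) i) = y := fun i hi => by
      have h : Nat.nth (· ∈ X) i ∈ X := Nat.nth_mem_of_lt_card hfin (by rw [hcard]; omega)
      generalize Nat.nth (· ∈ X) i = l at h ⊢
      rwa [hX, Finset.mem_filter, Finset.mem_range] at h
    obtain ⟨H, hH, hHe, -⟩ := hM.exists_levelMap_eq hn (e := fun i => n + Nat.nth (· ∈ X) i)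
      (Nat.le_add_right _ _) m (fun i hi => Nat.add_lt_add_left
        (Nat.nth_lt_nth_of_lt_card hfin (Nat.lt_succ_self i) (by rw [hcard]; omega)) n)
    refine ⟨F ∘ H, hM.comp_mem_Fixing hF hH, ?_, y, fun G hG hl => ?_⟩
    · rw [hM.levelMap_comp hF.1 hH.1]
      refine ((hM.levelMap_strictMono hF.1).monotone ?_).trans hFN
      refine ((hM.levelMap_strictMono hH.1).monotone (show m ≤ n + m by omega)).trans ?_
      rw [hHe m le_rfl]
      have := (hmemX m le_rfl).1
      omega
    · obtain ⟨i, hi⟩ := Nat.exists_eq_add_of_le (hM.le_levelMap hG.1 n)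
      have hHG : levelMap (H ∘ G) n = n + Nat.nth (· ∈ X) i := by
        rw [hM.levelMap_comp hH.1 hG.1, hi, hHe i (by omega)]
      have hmem := hmemX i (by omega)
      have := hc (H ∘ G) (hM.comp_mem_Fixing hH hG) (by omega)
      rw [hHG] at this
      exact this.trans hmem.2
  -- Without a letter at n, every member of `Fixing M n` is the identity on T(≤n), and there is only
  -- one colour to consider.
  · refine ⟨m, fun χ hχ => ⟨id, hM.id_mem_Fixing n, (hM.levelMap_id m).le, χ id,
      fun G hG _ => hχ _ _ ?_⟩⟩
    refine hM.agreeBelow_succ_of_levelMap_eq hG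
      (le_antisymm (not_lt.1 fun h => hn ?_) (hM.le_levelMap hG.1 n))
    obtain ⟨lam, hlam, -⟩ := hM.exists_letter_factor hG h
    exact ⟨lam, hlam⟩

/-! ### End-homogeneity and induction on the number of levels -/

/-- The values on the next level are determined by those below, if no level is skipped. -/
lemma agreeBelow_succ (hM : IsSMTree S M) {q : ℕ} {Q Q' : T → T} (hQ : Q ∈ M) (hQ' : Q' ∈ M)
    (h : AgreeBelow (q + 1) Q Q') (hl : levelMap Q (q + 1) = levelMap Q q + 1)
    (hl' : levelMap Q' (q + 1) = levelMap Q' q + 1) : AgreeBelow (q + 2) Q Q' := by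
  intro b hb
  rcases Nat.lt_succ_iff_lt_or_eq.1 hb with hb | hb
  · exact h b hb
  obtain ⟨a, hab⟩ := S.exists_covBy (b := b) (by omega)
  have hlab := S.level_covBy hab
  obtain ⟨p, c, hpc⟩ := S.succ_surj _ _ hab
  have key : ∀ E ∈ M, levelMap E (q + 1) = levelMap E q + 1 →
      S.succ (E a) (p.map E) c = some (E b) := by
    intro E hE hl
    obtain ⟨d, hd, hdb⟩ := (hM.shape E hE).weakly_preserving _ _ _ _ hpc
    have h1 := S.level_covBy (S.succ_covBy _ _ _ _ hd).1
    rw [hd, S.eq_of_le_of_level_eq hdb]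
    rw [h1, hM.levelMap_eq hE, hM.levelMap_eq hE, hb, hl, show level a = q by omega]
  have h1 := key Q hQ hl
  rw [h a (by omega), List.map_congr_left fun x hx => h x (by
    have := (S.succ_covBy _ _ _ _ hpc).2 x hx
    omega), key Q' hQ' hl', Option.some_inj] at h1
  exact h1.symm

/-- Induction on j, handling one value j of `levelMap G q` at a time. Such a G is K ∘ Q on T(≤q+1),
where Q sends q + 1 to j + 1 and K fixes T(≤j). As Q skips nothing between j and j + 1, it is
determined by G on T(≤q), and the pigeonhole principle at level j + 1 removes the dependence on K.
-/
lemma exists_end_homogeneous (hM : IsSMTree S M) {n q : ℕ} (hnq : n ≤ q + 1) (κ : Type u)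
    [Finite κ] (j : ℕ) : ∀ m, ∃ N, ∀ χ : (T → T) → κ, IsLocal (q + 2) χ →
      ∃ F ∈ Fixing M n, levelMap F m ≤ N ∧ ∀ G ∈ Fixing M n, ∀ G' ∈ Fixing M n,
        AgreeBelow (q + 1) G G' → levelMap G q < j → levelMap G (q + 1) ≤ m →
        levelMap G' (q + 1) ≤ m → χ (F ∘ G) = χ (F ∘ G') := by
  induction j with
  | zero =>
    intro m
    exact ⟨m, fun χ _ => ⟨id, hM.id_mem_Fixing n, (hM.levelMap_id m).le,
      fun G _ G' _ _ h => absurd h (by omega)⟩⟩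
  | succ j ih =>
    intro m
    rcases lt_or_ge j q with hj | hj
    · refine ⟨m, fun χ _ => ⟨id, hM.id_mem_Fixing n, (hM.levelMap_id m).le,
        fun G hG G' _ _ h => absurd h ?_⟩⟩
      have := hM.le_levelMap hG.1 q
      omega
    have := S.finite_Below_fun (q + 2) (j + 1)
    obtain ⟨N₁, hN₁⟩ := hM.exists_pigeonhole (j + 1) m
      ((Below T (q + 2) → {a : T // level a ≤ j + 1}) → κ)
    obtain ⟨N, hN⟩ := ih N₁
    refine ⟨N, fun χ hχ => ?_⟩
    obtain ⟨F₀, hF₀, hF₀N, hhom⟩ := hN χ hχ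
    obtain ⟨F₁, hF₁, hF₁N, c, hc⟩ := hN₁ _ (hχ.comp_extendBelow F₀)
    have hF₁n : F₁ ∈ Fixing M n := Fixing_anti (by omega) hF₁
    refine ⟨F₀ ∘ F₁, hM.comp_mem_Fixing hF₀ hF₁n, ?_, ?_⟩
    · rw [hM.levelMap_comp hF₀.1 hF₁.1]
      exact ((hM.levelMap_strictMono hF₀.1).monotone hF₁N).trans hF₀N
    intro G hG G' hG' hGG' hlt hm hm'
    -- Smaller values of `levelMap G q` are unaffected by F₁, which fixes T(≤j), so F₀ already deals
    -- with them.
    rcases Nat.lt_succ_iff_lt_or_eq.1 hlt with hlt | heq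
    · have hbound : ∀ E ∈ Fixing M n, levelMap E (q + 1) ≤ m →
          levelMap (F₁ ∘ E) (q + 1) ≤ N₁ := fun E hE hle => by
        rw [hM.levelMap_comp hF₁.1 hE.1]
        exact ((hM.levelMap_strictMono hF₁.1).monotone hle).trans hF₁N
      refine hhom (F₁ ∘ G) (hM.comp_mem_Fixing hF₁n hG) (F₁ ∘ G') (hM.comp_mem_Fixing hF₁n hG')
        (hGG'.comp_left F₁) ?_ (hbound G hG hm) (hbound G' hG' hm')
      rw [hM.levelMap_comp hF₁.1 hG.1, (hM.mem_Fixing hF₁.1).1 hF₁ _ (by omega)]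
      exact hlt
    · have key : ∀ E ∈ Fixing M n, levelMap E q = j → levelMap E (q + 1) ≤ m →
          ∃ Q ∈ M, AgreeBelow (q + 1) Q E ∧ levelMap Q (q + 1) = j + 1 ∧ levelMap Q q = j ∧
            ∀ x : Below T (q + 2) → {a : T // level a ≤ j + 1},
              AgreeBelow (q + 2) Q (extendBelow x) → χ ((F₀ ∘ F₁) ∘ E) = c x := by
        intro E hE hEj hEm
        have hlow : ∀ i < q + 1, levelMap E i < j + 1 := fun i hi => by
          have := (hM.levelMap_strictMono hE.1).monotone (Nat.le_of_lt_succ hi)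
          omega
        have hup : j + 1 ≤ levelMap E (q + 1) := by
          rw [← hEj]
          exact hM.levelMap_strictMono hE.1 (Nat.lt_succ_self q)
        obtain ⟨Q, hQ, K, hK, hKQ, hl⟩ := hM.exists_factor hE.1 hlow hup
        have hQE := hM.factor_agreeBelow hQ hK hKQ hl
        refine ⟨Q, hQ, hQE, hl, ?_, fun x hx => ?_⟩
        · rw [hM.levelMap_congr hQ hE.1 hQE (Nat.lt_succ_self q), hEj]
        · have hKl : levelMap K (j + 1) ≤ m := by
            rw [← hl, ← hM.levelMap_comp hK.1 hQ, hM.levelMap_congr (hM.comp_mem _ hK.1 _ hQ)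
              hE.1 hKQ (Nat.lt_succ_self _)]
            exact hEm
          rw [← hc K hK hKl]
          refine hχ _ _ fun a ha => ?_
          have h1 : K (Q a) = E a := hKQ a ha
          have h2 : Q a = extendBelow x a := hx a ha
          simp only [Function.comp]
          rw [← h1, h2]
      have heq' : levelMap G' q = j := by
        rw [← heq, hM.levelMap_congr hG.1 hG'.1 hGG' (Nat.lt_succ_self q)]
      obtain ⟨Q, hQ, hQG, hl, hlq, hcol⟩ := key G hG heq hm
      obtain ⟨Q', hQ', hQG', hl', hlq', hcol'⟩ := key G' hG' heq' hm'
      have hQQ' : AgreeBelow (q + 2) Q Q' := hM.agreeBelow_succ hQ hQ'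
        (hQG.trans (hGG'.trans hQG'.symm)) (by omega) (by omega)
      obtain ⟨x, hx⟩ := exists_agreeBelow_extendBelow (k := q + 2) (L := j + 1) (F := Q)
        fun a ha => by
          rw [hM.levelMap_eq hQ, ← hl]
          exact (hM.levelMap_strictMono hQ).monotone (by omega)
      rw [hcol x hx, hcol' x (hQQ'.symm.trans hx)]

/-- The finite Ramsey statement, for local colourings of functions `T → T`. -/
theorem exists_ramsey (hM : IsSMTree S M) (n k : ℕ) : ∀ (m : ℕ) (κ : Type u) [Finite κ],
    ∃ N, ∀ χ : (T → T) → κ, IsLocal (n + k) χ → ∃ F ∈ Fixing M n, levelMap F m ≤ N ∧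
      ∃ c, ∀ G ∈ Fixing M n, (∀ i < n + k, levelMap G i ≤ m) → χ (F ∘ G) = c := by
  classical
  induction k with
  | zero =>
    intro m κ _
    exact ⟨m, fun χ hχ => ⟨id, hM.id_mem_Fixing n, (hM.levelMap_id m).le, χ id,
      fun G hG _ => hχ _ _ hG.2⟩⟩
  | succ k ih =>
    intro m κ _
    rcases Nat.eq_zero_or_pos (n + k) with h0 | hpos
    -- Here there is no level q preceding the last one, so the pigeonhole principle is used
    -- directly.
    · obtain ⟨rfl, rfl⟩ : n = 0 ∧ k = 0 := by omega
      obtain ⟨N, hN⟩ := hM.exists_pigeonhole 0 m κ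
      refine ⟨N, fun χ hχ => ?_⟩
      obtain ⟨F, hF, hFN, c, hc⟩ := hN χ hχ
      exact ⟨F, hF, hFN, c, fun G hG h => hc G hG (h 0 (by omega))⟩
    obtain ⟨q, hq⟩ : ∃ q, n + k = q + 1 := ⟨n + k - 1, by omega⟩
    rw [hq] at ih
    rw [← Nat.add_assoc, hq]
    obtain ⟨N₁, hN₁⟩ := ih m κ
    -- Both bounds are N₁: functions H ∘ G send q + 1 to at most N₁, hence q strictly below N₁.
    obtain ⟨N, hN⟩ := hM.exists_end_homogeneous (n := n) (q := q) (by omega) κ N₁ N₁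
    refine ⟨N, fun χ hχ => ?_⟩
    obtain ⟨F, hF, hFN, hhom⟩ := hN χ hχ
    -- A function on T(≤q) is coloured through an arbitrary bounded extension to T(≤q+1); by
    -- end-homogeneity the choice is immaterial.
    obtain ⟨χ', hχ', hchoice⟩ := exists_isLocal_choice (k := q + 1)
      (P := fun E G => G ∈ Fixing M n ∧ AgreeBelow (q + 1) E G ∧ levelMap G (q + 1) ≤ N₁)
      (fun E E' h G hG => ⟨hG.1, h.symm.trans hG.2.1, hG.2.2⟩) (fun G => χ (F ∘ G)) (χ id)
    obtain ⟨H, hH, hHN, c, hc⟩ := hN₁ χ' hχ'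
    refine ⟨F ∘ H, hM.comp_mem_Fixing hF hH, ?_, c, fun G hG hl => ?_⟩
    · rw [hM.levelMap_comp hF.1 hH.1]
      exact ((hM.levelMap_strictMono hF.1).monotone hHN).trans hFN
    have hHG := hM.comp_mem_Fixing hH hG
    have hbound : levelMap (H ∘ G) (q + 1) ≤ N₁ := by
      rw [hM.levelMap_comp hH.1 hG.1]
      exact ((hM.levelMap_strictMono hH.1).monotone (hl _ (by omega))).trans hHN
    obtain ⟨E, ⟨hE, hagree, hEl⟩, hχE⟩ :=
      hchoice (H ∘ G) ⟨H ∘ G, hHG, fun _ _ => rfl, hbound⟩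
    rw [← hc G hG fun i hi => hl i (by omega), hχE]
    exact hhom (H ∘ G) hHG _ hE hagree
      ((hM.levelMap_strictMono hHG.1 (Nat.lt_succ_self q)).trans_le hbound) hbound hEl

end IsSMTree

end SuccTree

/-! ### From local colourings back to restrictions -/

theorem corollary1p5 {T : Type*} [PartialOrder T] {A : Type*} (S : SuccTree.STree T A)
    (M : Set (T → T)) (hM : SuccTree.IsSMTree S M) (n k m r : ℕ) :
    ∃ N : ℕ, ∀ χ : SuccTree.AMle M n k N → Fin r,
      ∃ f ∈ SuccTree.AMle M n m N,
        ∃ F ∈ SuccTree.Fixing M n, SuccTree.restrictBelow (n + m) F = f ∧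
          ∃ c : Fin r, ∀ g ∈ SuccTree.AMle M n k m,
            ∃ h : F ∘ g ∈ SuccTree.AMle M n k N, χ ⟨F ∘ g, h⟩ = c := by
  classical
  -- The bound n + m controls F on all of T(<n+m). The colour `none` is for restrictions outside the
  -- domain of χ. The lift is to the universe of T, where the colours must live because the
  -- induction uses colours that are functions on sets of nodes.
  obtain ⟨N, hN⟩ := hM.exists_ramsey n k (n + m) (ULift (Option (Fin r)))
  -- The maximum ensures that the restricted identity lies in the domain of χ, which supplies the
  -- default value for `Option.getD`.
  refine ⟨max N (n + k), fun χ => ?_⟩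
  have hid : SuccTree.restrictBelow (n + k) id ∈ SuccTree.AMle M n k (max N (n + k)) :=
    ⟨⟨id, hM.id_mem_Fixing n, rfl⟩, fun a ha => by
      have : SuccTree.level a.1 ≤ max N (n + k) := by omega
      exact this⟩
  obtain ⟨F, hF, hFN, c, hc⟩ := hN
    (fun E => ULift.up (if h : SuccTree.restrictBelow (n + k) E ∈
      SuccTree.AMle M n k (max N (n + k)) then some (χ ⟨_, h⟩) else none))
    (by
      intro E E' h
      have h1 : SuccTree.restrictBelow (n + k) E = SuccTree.restrictBelow (n + k) E' :=
        funext fun a => h a.1 a.2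
      simp only [h1])
  have hmono := (hM.levelMap_strictMono hF.1).monotone
  refine ⟨SuccTree.restrictBelow (n + m) F, ⟨⟨F, hF, rfl⟩, fun a ha => ?_⟩, F, hF, rfl,
    c.down.getD (χ ⟨_, hid⟩), ?_⟩
  · have h1 : SuccTree.level (F a.1) ≤ N := by
      rw [hM.levelMap_eq hF.1]
      exact (hmono a.2.le).trans hFN
    exact h1.trans (le_max_left _ _)
  · rintro _ ⟨⟨G, hG, rfl⟩, hGm⟩
    have hFG : F ∘ SuccTree.restrictBelow (n + k) G = SuccTree.restrictBelow (n + k) (F ∘ G) :=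
      rfl
    have hGl : ∀ i < n + k, SuccTree.levelMap G i ≤ m := by
      intro i hi
      obtain ⟨a, ha⟩ := hM.exists_level (n + k - 1)
      have h1 : SuccTree.level (G a) ≤ m := hGm ⟨a, by omega⟩ (by simp only; omega)
      rw [hM.levelMap_eq hG.1, ha] at h1
      exact ((hM.levelMap_strictMono hG.1).monotone (by omega)).trans h1
    have hmem : F ∘ SuccTree.restrictBelow (n + k) G ∈
        SuccTree.AMle M n k (max N (n + k)) := by
      refine ⟨⟨F ∘ G, hM.comp_mem_Fixing hF hG, rfl⟩, fun a ha => ?_⟩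
      have h1 : SuccTree.level (F (G a.1)) ≤ N := by
        rw [hM.levelMap_eq hF.1, hM.levelMap_eq hG.1]
        exact (hmono ((hGl _ a.2).trans (by omega))).trans hFN
      exact h1.trans (le_max_left _ _)
    refine ⟨hmem, ?_⟩
    have h1 := hc G hG fun i hi => (hGl i hi).trans (by omega)
    rw [← h1]
    simp only [← hFG, dif_pos hmem, Option.getD_some]
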